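/- For $n\ge 1$ let $D_n$ be the group of all permutations $\pi$ of $[-n,n]\setminus\{0\}=\{-n,\dots,-1,1,\dots,n\}$ such that $\pi_{-i}=-\pi_i$ for all $i$ and the number of $i\in\{1,\dots,n\}$ with $\pi_i<0$ is even. Its simple reflections are, in cycle notation, $(i,\,i+1)(-i,\,-(i+1))$ for $1\le i\le n-1$ and, if $n\ge2$, $(1,-2)(-1,2)$; its reflections are the conjugates in $D_n$ of the simple reflections; the length $\ell(w)$ of $w\in D_n$ is the least $k$ such that $w$ is a product of $k$ simple reflections. Let $n\ge1$ and $t\ge0$, where $t=0$ if $n=1$ (the group $D_1$ is trivial and has no reflections). Let $\pi^{(t)}=r_1r_2\cdots r_t$, where $r_1,\dots,r_t$ are chosen independently and uniformly from the set of reflections of $D_n$ (so $\pi^{(0)}$ is the identity). Then the following holds. (a) The expected length of $\pi^{(t)}$ is $$\mathbb{E}\bigl[\ell(\pi^{(t)})\bigr]=\frac{n(n-1)}{2}-\frac{n(2n-1)}{6}\left(1-\frac2n\right)^t-\frac{n(n-2)}{6}\left(1-\frac4n\right)^t.$$ (b) If $i,j\in[-n,n]\setminus\{0\}$ and $j>|i|$,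 the probability that $\pi^{(t)}_i>\pi^{(t)}_j$ is $$\frac12-\frac{j-i-1+\operatorname{sgn} i}{2(n-1)}\left(1-\frac2n\right)^t+\left(\frac{j-i-1+\operatorname{sgn} i}{2(n-1)}-\frac12\right)\left(1-\frac4n\right)^t.$$ Here $0^0=1$. -/

import Mathlib

section General

/-- `E^M_{R,φ}(t) = |R|^{-t} ∑_{r₁,…,r_t ∈ R} φ(r₁ ⋯ r_t)`: the expected value of `φ` at a product
of `t` elements chosen independently and uniformly from the finite set `R`. -/
noncomputable def expectedLength {M : Type*} [Monoid M] (R : Finset M) (φ : M → ℕ) (t : ℕ) : ℝ :=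
  1 / (R.card : ℝ) ^ t *
    ∑ r ∈ Fintype.piFinset (fun _ : Fin t => R), (φ (List.ofFn r).prod : ℝ)

open Classical in
/-- The probability that a product `r₁ ⋯ r_t` of `t` elements chosen independently and uniformly
from the finite set `R` has the property `P`. -/
noncomputable def productProb {M : Type*} [Monoid M] (R : Finset M) (t : ℕ) (P : M → Prop) : ℝ :=
  (((Fintype.piFinset (fun _ : Fin t => R)).filter (fun r => P (List.ofFn r).prod)).card : ℝ) /
    (R.card : ℝ) ^ t

/-- The minimal `k` such that `w` is a product of `k` elements of `S`
(used only when `S` generates the monoid). -/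
noncomputable def wordLength {M : Type*} [Monoid M] (S : Set M) (w : M) : ℕ :=
  sInf {k : ℕ | ∃ l : List M, (∀ s ∈ l, s ∈ S) ∧ l.length = k ∧ l.prod = w}

end General

namespace TypeD

/-- The set `[-n, n] \ {0}` of integers, as a type. -/
abbrev Idx (n : ℕ) : Type := {i : ℤ // i ∈ (Finset.Icc (-(n : ℤ)) (n : ℤ)).erase 0}

instance (n : ℕ) : Neg (Idx n) where
  neg i := ⟨-i.1, by
    have h := i.2
    simp only [Finset.mem_erase, Finset.mem_Icc] at h ⊢
    omega⟩

@[simp] theorem coe_neg {n : ℕ} (i : Idx n) : ((-i : Idx n) : ℤ) = -(i : ℤ) := rfl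

theorem coe_ne_zero {n : ℕ} (i : Idx n) : (i : ℤ) ≠ 0 := (Finset.mem_erase.mp i.2).1

theorem neg_neg_idx {n : ℕ} (i : Idx n) : -(-i) = i := Subtype.ext (by simp)

/-- The permutations `π` of `[-n, n] \ {0}` with `π(-i) = -π(i)`. -/
def IsSigned {n : ℕ} (π : Equiv.Perm (Idx n)) : Prop := ∀ i, π (-i) = -(π i)

/-- The set of `i ∈ {1, …, n}` such that `π(i) < 0`. -/
noncomputable def negatives {n : ℕ} (π : Equiv.Perm (Idx n)) : Finset (Idx n) :=
  Finset.univ.filter (fun i => 0 < (i : ℤ) ∧ (π i : ℤ) < 0)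

/-- The product of the signs of `π(i)` for `1 ≤ i ≤ n`. -/
noncomputable def signProd {n : ℕ} (π : Equiv.Perm (Idx n)) : ℤ :=
  ∏ i ∈ Finset.univ.filter (fun i : Idx n => 0 < (i : ℤ)), Int.sign (π i : ℤ)

theorem signProd_eq {n : ℕ} (π : Equiv.Perm (Idx n)) :
    signProd π = (-1) ^ (negatives π).card := by
  unfold signProd negatives
  rw [← Finset.filter_filter, ← Finset.prod_const,
    Finset.prod_filter (fun i : Idx n => (π i : ℤ) < 0)]
  refine Finset.prod_congr rfl fun i _ => ?_
  split_ifs with h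
  · exact Int.sign_eq_neg_one_of_neg h
  · exact Int.sign_eq_one_of_pos (lt_of_le_of_ne (not_lt.mp h) (coe_ne_zero _).symm)

theorem even_iff {n : ℕ} (π : Equiv.Perm (Idx n)) :
    Even (negatives π).card ↔ signProd π = 1 := by
  rw [signProd_eq]
  exact (neg_one_pow_eq_one_iff_even (by norm_num)).symm

theorem IsSigned.mul {n : ℕ} {σ τ : Equiv.Perm (Idx n)} (hσ : IsSigned σ) (hτ : IsSigned τ) :
    IsSigned (σ * τ) := fun i => by
  rw [Equiv.Perm.mul_apply, Equiv.Perm.mul_apply, hτ i, hσ]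

theorem IsSigned.inv {n : ℕ} {σ : Equiv.Perm (Idx n)} (hσ : IsSigned σ) : IsSigned σ⁻¹ :=
  fun i => by
    apply σ.injective
    rw [hσ]
    simp

theorem signProd_mul {n : ℕ} {σ τ : Equiv.Perm (Idx n)} (hσ : IsSigned σ) (hτ : IsSigned τ) :
    signProd (σ * τ) = signProd σ * signProd τ := by
  have key : ∏ i ∈ Finset.univ.filter (fun i : Idx n => 0 < (i : ℤ)),
        (Int.sign (τ i : ℤ) * Int.sign (σ (τ i) : ℤ)) =
      ∏ i ∈ Finset.univ.filter (fun i : Idx n => 0 < (i : ℤ)), Int.sign (σ i : ℤ) := by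
    refine Finset.prod_bij (fun i _ => if 0 < (τ i : ℤ) then τ i else -(τ i)) ?_ ?_ ?_ ?_
    · intro i _
      have := coe_ne_zero (τ i)
      simp only [Finset.mem_filter, Finset.mem_univ, true_and]
      split_ifs with h
      · exact h
      · rw [coe_neg]; omega
    · intro i hi j hj hij
      simp only [Finset.mem_filter, Finset.mem_univ, true_and] at hi hj
      split_ifs at hij with h1 h2 h2
      · exact τ.injective hij
      · rw [← hτ j] at hij
        have := congrArg Subtype.val (τ.injective hij)
        rw [coe_neg] at this
        omega
      · rw [← hτ i] at hij
        have := congrArg Subtype.val (τ.injective hij)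
        rw [coe_neg] at this
        omega
      · rw [← hτ i, ← hτ j] at hij
        have := congrArg Subtype.val (τ.injective hij)
        rw [coe_neg, coe_neg] at this
        exact Subtype.ext (by omega)
    · intro k hk
      simp only [Finset.mem_filter, Finset.mem_univ, true_and] at hk
      have h0 := coe_ne_zero (τ⁻¹ k)
      by_cases h : 0 < ((τ⁻¹ k : Idx n) : ℤ)
      · exact ⟨τ⁻¹ k, by simpa using h, by simp [hk]⟩
      · refine ⟨-(τ⁻¹ k), ?_, ?_⟩
        · simp only [Finset.mem_filter, Finset.mem_univ, true_and, coe_neg]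
          omega
        · rw [hτ]
          have : ¬ (0 < ((-(τ (τ⁻¹ k)) : Idx n) : ℤ)) := by
            rw [show τ (τ⁻¹ k) = k by simp, coe_neg]; omega
          rw [if_neg this, neg_neg_idx]
          simp
    · intro i _
      have h0 := coe_ne_zero (τ i)
      split_ifs with h
      · rw [Int.sign_eq_one_of_pos h, one_mul]
      · rw [Int.sign_eq_neg_one_of_neg (show (τ i : ℤ) < 0 by omega), hσ, coe_neg, Int.sign_neg]
        ring
  rw [Finset.prod_mul_distrib] at key
  have hsq : signProd τ * signProd τ = 1 := by
    rw [signProd_eq, ← pow_add, ← two_mul, pow_mul]; simp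
  have key' : signProd τ * signProd (σ * τ) = signProd σ := key
  calc signProd (σ * τ) = (signProd τ * signProd τ) * signProd (σ * τ) := by rw [hsq, one_mul]
    _ = signProd σ * signProd τ := by rw [mul_assoc, key', mul_comm]

theorem signProd_one {n : ℕ} : signProd (1 : Equiv.Perm (Idx n)) = 1 := by
  unfold signProd
  refine Finset.prod_eq_one fun i hi => ?_
  simp only [Finset.mem_filter, Finset.mem_univ, true_and] at hi
  exact Int.sign_eq_one_of_pos hi

/-- The group `D_n` of permutations `π` of `[-n, n] \ {0}` such that `π(-i) = -π(i)` and the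
number of `i ∈ {1, …, n}` with `π(i) < 0` is even. -/
def D (n : ℕ) : Subgroup (Equiv.Perm (Idx n)) where
  carrier := {π | IsSigned π ∧ Even (negatives π).card}
  mul_mem' := by
    rintro σ τ ⟨hσ, eσ⟩ ⟨hτ, eτ⟩
    refine ⟨hσ.mul hτ, ?_⟩
    rw [even_iff] at *
    rw [signProd_mul hσ hτ, eσ, eτ, one_mul]
  one_mem' := ⟨fun _ => rfl, (even_iff _).mpr signProd_one⟩
  inv_mem' := by
    rintro σ ⟨hσ, eσ⟩
    refine ⟨hσ.inv, ?_⟩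
    rw [even_iff] at *
    have h := signProd_mul hσ.inv hσ
    rw [inv_mul_cancel, signProd_one, eσ, mul_one] at h
    exact h.symm

/-- The simple reflections (Coxeter generators) of `D_n`, in cycle notation:
`(i, i+1)(-i, -(i+1))` for `1 ≤ i ≤ n - 1`, and `(1, -2)(-1, 2)`. -/
def simpleReflections (n : ℕ) : Set (D n) :=
  {s | (∃ i j : Idx n, 1 ≤ (i : ℤ) ∧ (j : ℤ) = i + 1 ∧
          (s : Equiv.Perm (Idx n)) = Equiv.swap i j * Equiv.swap (-i) (-j)) ∨
       (∃ i j : Idx n, (i : ℤ) = 1 ∧ (j : ℤ) = 2 ∧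
          (s : Equiv.Perm (Idx n)) = Equiv.swap i (-j) * Equiv.swap (-i) j)}

/-- The Coxeter length of an element of `D_n`. -/
noncomputable def length (n : ℕ) (w : D n) : ℕ := wordLength (simpleReflections n) w

open Classical in
/-- The set of reflections of `D_n`: the elements conjugate to some simple reflection. -/
noncomputable def reflections (n : ℕ) : Finset (D n) :=
  Finset.univ.filter (fun r => ∃ s ∈ simpleReflections n, IsConj s r)

end TypeD

/-! The proof diagonalises the random walk on two functions. For fixed `i`, `j` with `|i| ≠ |j|`,
put `a = w i`, `b = w j`, `s = sign (a - b)` and `Δ = shrink a - shrink b`, where `shrink x = x -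
sign x`. Summing over all `n (n - 1)` reflections applied on the left sends `Δ` to `(n - 1)(n - 2)
Δ` (`sum_reflections_shrink`) and `s` to `(n - 1)(n - 4) s + 2 Δ` (`sum_reflections_sign_sub`). The
span of `s` and `Δ` is therefore invariant, and `Δ` and `(n - 1) s - Δ` are eigenfunctions of the
averaging operator, with eigenvalues `1 - 2/n` and `1 - 4/n`.

The indicator of `b < a` is `(1 + s) / 2`, a combination of a constant and these two eigenfunctions;
this gives (b).

For (a), twice the Coxeter length is the number of pairs in `rootPairs n` reversed by `w`
(`two_mul_length`), each positive root being represented by two pairs. Linearity of expectation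
reduces (a) to (b), the number of pairs, and the sum of `shrink q - shrink p` over them, which is `2
∑ shrink c ^ 2`. -/

/-! ### Random products and word length in a monoid -/

theorem sum_prod_ofFn_of_eigen {M : Type*} [Monoid M] (R : Finset M) (G : M → ℝ) (c : ℝ)
    (h : ∀ m, ∑ r ∈ R, G (r * m) = c * G m) (t : ℕ) :
    ∑ r ∈ Fintype.piFinset (fun _ : Fin t => R), G (List.ofFn r).prod = c ^ t * G 1 := by
  induction t with
  | zero => simp
  | succ t ih =>
    -- The leftmost factor is split off, because `h` concerns left multiplication.
    have key : ∑ r ∈ Fintype.piFinset (fun _ : Fin (t + 1) => R), G (List.ofFn r).prod =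
        ∑ x ∈ Fintype.piFinset (fun _ : Fin t => R) ×ˢ R, G (x.2 * (List.ofFn x.1).prod) := by
      refine Finset.sum_nbij' (fun r => (Fin.tail r, r 0)) (fun x => Fin.cons x.2 x.1) ?_ ?_ ?_ ?_ ?_
      · intro r hr
        rw [Fintype.mem_piFinset] at hr
        simp [Fintype.mem_piFinset, Fin.tail, hr]
      · intro x hx
        simp only [Finset.mem_product, Fintype.mem_piFinset] at hx ⊢
        intro i
        refine Fin.cases ?_ ?_ i
        · simpa using hx.2
        · simpa using hx.1
      · intro r _
        simp
      · intro x _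
        simp
      · intro r _
        rw [List.ofFn_succ, List.prod_cons]
        rfl
    rw [key, Finset.sum_product]
    simp only [h]
    rw [← Finset.mul_sum, ih, pow_succ']
    ring

theorem wordLength_eq {M : Type*} [Monoid M] {S : Set M} {w : M} {k : ℕ}
    (hex : ∃ l : List M, (∀ s ∈ l, s ∈ S) ∧ l.length = k ∧ l.prod = w)
    (hle : ∀ l : List M, (∀ s ∈ l, s ∈ S) → l.prod = w → k ≤ l.length) :
    wordLength S w = k := by
  refine le_antisymm (Nat.sInf_le hex) (le_csInf ⟨k, hex⟩ ?_)
  rintro m ⟨l, hl, rfl, hp⟩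
  exact hle l hl hp

namespace TypeD

/-! ### The reflections of `D n` as signed transpositions -/

variable {n : ℕ}

theorem idx_ext_iff {a b : Idx n} : a = b ↔ (a : ℤ) = b := Subtype.ext_iff

theorem idx_bounds (a : Idx n) : -(n : ℤ) ≤ a ∧ (a : ℤ) ≤ n ∧ (a : ℤ) ≠ 0 := by
  have h := a.2
  simp only [Finset.mem_erase, Finset.mem_Icc] at h
  exact ⟨h.2.1, h.2.2, h.1⟩

theorem ne_neg_self (a : Idx n) : a ≠ -a := by
  have := coe_ne_zero a
  rw [Ne, idx_ext_iff, coe_neg]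
  omega

/-- The index with a given value. -/
def mkIdx (k : ℤ) (h : -(n : ℤ) ≤ k ∧ k ≤ n ∧ k ≠ 0) : Idx n :=
  ⟨k, by simp only [Finset.mem_erase, Finset.mem_Icc]; omega⟩

@[simp] theorem coe_mkIdx (k : ℤ) (h : -(n : ℤ) ≤ k ∧ k ≤ n ∧ k ≠ 0) :
    ((mkIdx k h : Idx n) : ℤ) = k := rfl

/-- The signed permutation exchanging `a` with `b` and `-a` with `-b`. -/
def ref (a b : Idx n) : Equiv.Perm (Idx n) := Equiv.swap a b * Equiv.swap (-a) (-b)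

/-- `a` and `b` have different absolute values. -/
def Apart (a b : Idx n) : Prop := a ≠ b ∧ a ≠ -b

instance (a b : Idx n) : Decidable (Apart a b) := by unfold Apart; infer_instance

theorem apart_iff {a b : Idx n} : Apart a b ↔ (a : ℤ) ≠ b ∧ (a : ℤ) ≠ -b := by
  rw [Apart, Ne, Ne, idx_ext_iff, idx_ext_iff, coe_neg]

theorem Apart.symm {a b : Idx n} (h : Apart a b) : Apart b a := by
  rw [apart_iff] at *
  omega

theorem apart_comm {a b : Idx n} : Apart a b ↔ Apart b a := ⟨Apart.symm, Apart.symm⟩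

theorem Apart.map {a b : Idx n} (h : Apart a b) {w : Equiv.Perm (Idx n)} (hw : IsSigned w) :
    Apart (w a) (w b) := by
  refine ⟨fun e => h.1 (w.injective e), fun e => h.2 (w.injective ?_)⟩
  rw [e, hw]

theorem coe_swap_apply (a b x : Idx n) : (Equiv.swap a b x : ℤ) =
    if (x : ℤ) = a then (b : ℤ) else if (x : ℤ) = b then (a : ℤ) else x := by
  rw [Equiv.swap_apply_def]
  simp only [idx_ext_iff]
  split_ifs <;> rfl

theorem coe_ref_apply {a b : Idx n} (h : Apart a b) (x : Idx n) :
    (ref a b x : ℤ) = if (x : ℤ) = a then (b : ℤ) else if (x : ℤ) = b then (a : ℤ) else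
      if (x : ℤ) = -a then -(b : ℤ) else if (x : ℤ) = -b then -(a : ℤ) else x := by
  rw [apart_iff] at h
  have ha := coe_ne_zero a
  have hb := coe_ne_zero b
  rw [ref, Equiv.Perm.mul_apply, coe_swap_apply, coe_swap_apply]
  simp only [coe_neg]
  split_ifs <;> omega

theorem ref_apply {a b : Idx n} (h : Apart a b) (x : Idx n) :
    ref a b x = if x = a then b else if x = b then a else if x = -a then -b
      else if x = -b then -a else x := by
  have hx := coe_ref_apply h x
  simp only [idx_ext_iff, coe_neg] at hx ⊢
  rw [hx]
  split_ifs <;> rfl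

theorem ref_comm {a b : Idx n} : ref a b = ref b a := by
  rw [ref, ref, Equiv.swap_comm a b, Equiv.swap_comm (-a) (-b)]

theorem ref_neg_neg {a b : Idx n} (h : Apart a b) : ref (-a) (-b) = ref a b := by
  have h' : Apart (-a) (-b) := by rw [apart_iff] at *; simp only [coe_neg]; omega
  rw [apart_iff] at h
  ext x
  rw [coe_ref_apply h', coe_ref_apply (apart_iff.2 h)]
  have ha := coe_ne_zero a
  have hb := coe_ne_zero b
  simp only [coe_neg]
  split_ifs <;> omega

theorem isSigned_ref {a b : Idx n} (h : Apart a b) : IsSigned (ref a b) := by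
  intro x
  rw [idx_ext_iff, coe_neg, coe_ref_apply h, coe_ref_apply h]
  rw [apart_iff] at h
  have ha := coe_ne_zero a
  have hb := coe_ne_zero b
  have hx := coe_ne_zero x
  simp only [coe_neg]
  split_ifs <;> omega

theorem ref_apply_left {a b : Idx n} (h : Apart a b) : ref a b a = b := by
  rw [ref_apply h, if_pos rfl]

theorem ref_apply_right {a b : Idx n} (h : Apart a b) : ref a b b = a := by
  rw [ref_comm, ref_apply_left h.symm]

theorem ref_apply_of_apart {a b x : Idx n} (h : Apart a b) (ha : Apart x a) (hb : Apart x b) :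
    ref a b x = x := by
  rw [ref_apply h, if_neg ha.1, if_neg hb.1, if_neg ha.2, if_neg hb.2]

theorem ref_mul_self {a b : Idx n} (h : Apart a b) : ref a b * ref a b = 1 := by
  ext x
  rw [Equiv.Perm.mul_apply, coe_ref_apply h, coe_ref_apply h]
  rw [apart_iff] at h
  have ha := coe_ne_zero a
  have hb := coe_ne_zero b
  simp only [Equiv.Perm.coe_one, id]
  split_ifs <;> omega

theorem conj_ref {a b : Idx n} {w : Equiv.Perm (Idx n)} (hw : IsSigned w) :
    w * ref a b * w⁻¹ = ref (w a) (w b) := by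
  rw [ref, ref, ← hw, ← hw, Equiv.swap_apply_apply, Equiv.swap_apply_apply]
  group

/-- A reflection moving `a` is determined by the image of `a`. -/
theorem ref_eq_of_apply_ne {a b x : Idx n} (h : Apart a b) (hx : ref a b x ≠ x) :
    Apart x (ref a b x) ∧ ref a b = ref x (ref a b x) := by
  have hx' := ref_apply h x
  have h1 : Apart b a := h.symm
  have h2 : Apart (-a) (-b) := by rw [apart_iff] at *; simp only [coe_neg]; omega
  have h3 : Apart (-b) (-a) := h2.symm
  split_ifs at hx' with c1 c2 c3 c4
  · rw [hx', c1]; exact ⟨h, rfl⟩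
  · rw [hx', c2]; exact ⟨h1, ref_comm⟩
  · rw [hx', c3]; exact ⟨h2, (ref_neg_neg h).symm⟩
  · rw [hx', c4]; exact ⟨h3, by rw [ref_comm, ref_neg_neg h1]⟩
  · exact absurd hx' hx

/-- The pairs `(a, b)`, `(b, a)`, `(-a, -b)`, `(-b, -a)` give the same permutation, and one of them
has its entry of larger absolute value second and positive. -/
theorem exists_normal_form {a b : Idx n} (h : Apart a b) :
    ∃ i j : Idx n, |(i : ℤ)| < j ∧ ref a b = ref i j := by
  have hab := apart_iff.1 h
  have hn : Apart (-a) (-b) := by rw [apart_iff] at *; simp only [coe_neg]; omega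
  have ha := coe_ne_zero a
  have hb := coe_ne_zero b
  rcases lt_or_gt_of_ne (show |(a : ℤ)| ≠ |(b : ℤ)| by rw [Ne, abs_eq_abs]; omega) with hlt | hlt
  · rcases lt_or_gt_of_ne hb with hs | hs
    · refine ⟨-a, -b, ?_, (ref_neg_neg h).symm⟩
      rwa [coe_neg, coe_neg, abs_neg, ← abs_of_neg hs]
    · exact ⟨a, b, by rwa [← abs_of_pos hs], rfl⟩
  · rcases lt_or_gt_of_ne ha with hs | hs
    · refine ⟨-b, -a, ?_, by rw [ref_comm (a := -b), ref_neg_neg h]⟩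
      rwa [coe_neg, coe_neg, abs_neg, ← abs_of_neg hs]
    · exact ⟨b, a, by rwa [← abs_of_pos hs], ref_comm⟩

theorem apart_of_abs_lt {i j : Idx n} (h : |(i : ℤ)| < j) : Apart i j := by
  rw [abs_lt] at h
  rw [apart_iff]
  omega

theorem ref_mem_D {a b : Idx n} (h : Apart a b) : ref a b ∈ D n := by
  obtain ⟨i, j, hij, e⟩ := exists_normal_form h
  have hap := apart_of_abs_lt hij
  rw [e]
  refine ⟨isSigned_ref hap, ?_⟩
  have hi := coe_ne_zero i
  rw [abs_lt] at hij
  rcases lt_or_gt_of_ne hi with hs | hs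
  · have : negatives (ref i j) = {-i, j} := by
      ext x
      simp only [negatives, Finset.mem_filter, Finset.mem_univ, true_and, Finset.mem_insert,
        Finset.mem_singleton, coe_ref_apply hap, idx_ext_iff, coe_neg]
      split_ifs <;> omega
    rw [this, Finset.card_pair (by rw [Ne, idx_ext_iff, coe_neg]; omega)]
    exact even_two
  · have : negatives (ref i j) = ∅ := by
      ext x
      simp only [negatives, Finset.mem_filter, Finset.mem_univ, true_and, Finset.notMem_empty,
        coe_ref_apply hap, iff_false]
      split_ifs <;> omega
    rw [this]
    simp

theorem exists_ref_of_mem_simpleReflections {s : D n} (hs : s ∈ simpleReflections n) :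
    ∃ a b : Idx n, Apart a b ∧ (s : Equiv.Perm (Idx n)) = ref a b := by
  rcases hs with ⟨i, j, hi, hj, e⟩ | ⟨i, j, hi, hj, e⟩
  · exact ⟨i, j, by rw [apart_iff]; omega, e⟩
  · exact ⟨i, -j, by rw [apart_iff, coe_neg]; omega, by rw [e, ref, neg_neg_idx]⟩

/-- `ref a b` is conjugate in `D n` to a simple reflection. -/
def ConjSimple (a b : Idx n) : Prop :=
  ∃ s ∈ simpleReflections n, ∃ w : D n, (w * s * w⁻¹ : Equiv.Perm (Idx n)) = ref a b

theorem ConjSimple.of_map {a b c d : Idx n} (hcd : Apart c d)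
    (h : ConjSimple (ref c d a) (ref c d b)) : ConjSimple a b := by
  obtain ⟨s, hs, w, e⟩ := h
  refine ⟨s, hs, ⟨ref c d, ref_mem_D hcd⟩ * w, ?_⟩
  have hc := conj_ref (a := a) (b := b) (isSigned_ref hcd)
  rw [← e] at hc
  rw [Subgroup.coe_mul, mul_inv_rev]
  calc ref c d * w * s * ((w : Equiv.Perm (Idx n))⁻¹ * (ref c d)⁻¹)
      = ref c d * (w * s * (w : Equiv.Perm (Idx n))⁻¹) * (ref c d)⁻¹ := by group
    _ = ref c d * (ref c d * ref a b * (ref c d)⁻¹) * (ref c d)⁻¹ := by rw [hc]; rfl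
    _ = (ref c d * ref c d) * ref a b * (ref c d * ref c d)⁻¹ := by group
    _ = ref a b := by rw [ref_mul_self hcd]; simp

/-- Induction on the larger entry: conjugating by the simple reflection `ref p j` with `p = j - 1`
replaces `j` by `p`. The base cases `i = j - 1` and `(i, j) = (-1, 2)` are the generators
themselves. -/
theorem conjSimple_of_abs_lt (m : ℕ) : ∀ i j : Idx n, (j : ℤ) ≤ m → |(i : ℤ)| < j →
    ConjSimple i j := by
  induction m with
  | zero =>
    intro i j hj hij
    have := abs_nonneg (i : ℤ)
    omega
  | succ m ih =>
    intro i j hj hij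
    have hap := apart_of_abs_lt hij
    have hij' := abs_lt.1 hij
    have hi := idx_bounds i
    have hjb := idx_bounds j
    by_cases h1 : (i : ℤ) = j - 1
    · exact ⟨⟨ref i j, ref_mem_D hap⟩, Or.inl ⟨i, j, by omega, by omega, rfl⟩, 1, by simp⟩
    by_cases h2 : (j : ℤ) = 2
    · refine ⟨⟨ref i j, ref_mem_D hap⟩, Or.inr ⟨-i, j, by rw [coe_neg]; omega, h2, ?_⟩, 1, by simp⟩
      show ref i j = Equiv.swap (-i) (-j) * Equiv.swap (- -i) j
      rw [neg_neg_idx, ← ref_neg_neg hap, ref, neg_neg_idx, neg_neg_idx]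
    let p : Idx n := mkIdx (j - 1) (by omega)
    have hp : (p : ℤ) = j - 1 := rfl
    have hpj : Apart p j := by rw [apart_iff]; omega
    have step : ∀ k : Idx n, |(k : ℤ)| < p → ConjSimple k j := by
      intro k hk
      have hk' := abs_lt.1 hk
      apply ConjSimple.of_map hpj
      rw [ref_apply_right hpj, ref_apply_of_apart hpj (apart_of_abs_lt hk)
        (by rw [apart_iff]; omega)]
      exact ih k p (by omega) hk
    -- `ref p j` commutes with `ref (-p) j`, so the descent would stall here; exchanging `p` with `q
    -- = j - 2` first turns `-p` into `-q`, to which `step` applies.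
    by_cases h3 : (i : ℤ) = -p
    · let q : Idx n := mkIdx (j - 2) (by omega)
      have hq : (q : ℤ) = j - 2 := rfl
      have hqp : Apart q p := by rw [apart_iff]; omega
      apply ConjSimple.of_map hqp
      rw [ref_apply_of_apart hqp (x := j) (by rw [apart_iff]; omega) hpj.symm]
      have hi' : i = -p := by rw [idx_ext_iff, coe_neg, h3]
      rw [hi', isSigned_ref hqp, ref_apply_right hqp]
      apply step
      rw [coe_neg, abs_lt]
      omega
    · apply step
      rw [abs_lt]
      omega

theorem mem_reflections_iff {r : D n} :
    r ∈ reflections n ↔ ∃ a b : Idx n, Apart a b ∧ (r : Equiv.Perm (Idx n)) = ref a b := by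
  simp only [reflections, Finset.mem_filter, Finset.mem_univ, true_and]
  constructor
  · rintro ⟨s, hs, hc⟩
    obtain ⟨w, hw⟩ := isConj_iff.1 hc
    obtain ⟨a, b, hab, e⟩ := exists_ref_of_mem_simpleReflections hs
    refine ⟨(w : Equiv.Perm (Idx n)) a, (w : Equiv.Perm (Idx n)) b, hab.map w.2.1, ?_⟩
    rw [← hw, ← conj_ref w.2.1, ← e]
    rfl
  · rintro ⟨a, b, hab, e⟩
    obtain ⟨i, j, hij, e'⟩ := exists_normal_form hab
    obtain ⟨s, hs, w, hw⟩ := conjSimple_of_abs_lt n i j (idx_bounds j).2.1 hij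
    refine ⟨s, hs, isConj_iff.2 ⟨w, Subtype.ext ?_⟩⟩
    rw [e, e', ← hw]
    rfl

/-! ### Sums over indices and over reflections -/

theorem sum_idx (f : ℤ → ℤ) :
    ∑ c : Idx n, f c = (∑ k ∈ Finset.Icc (-(n : ℤ)) n, f k) - f 0 := by
  rw [Finset.sum_coe_sort ((Finset.Icc (-(n : ℤ)) (n : ℤ)).erase 0) f,
    ← Finset.sum_erase_add (Finset.Icc (-(n : ℤ)) n) f (a := 0)
      (by rw [Finset.mem_Icc]; omega)]
  ring

theorem card_idx : Fintype.card (Idx n) = 2 * n := by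
  rw [Fintype.card_coe, Finset.card_erase_of_mem (by rw [Finset.mem_Icc]; omega), Int.card_Icc]
  omega

theorem sum_apart (a : Idx n) (f : Idx n → ℤ) :
    ∑ c with Apart c a, f c = ∑ c, f c - f a - f (-a) := by
  have h : Finset.univ.filter (fun c : Idx n => Apart c a) =
      (Finset.univ.erase a).erase (-a) := by
    ext c
    rw [Finset.mem_filter, Finset.mem_erase, Finset.mem_erase]
    exact ⟨fun h => ⟨h.2.2, h.2.1, h.1⟩, fun h => ⟨h.2.2, h.2.1, h.1⟩⟩
  have h1 := Finset.sum_erase_add Finset.univ f (Finset.mem_univ a)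
  have h2 := Finset.sum_erase_add (Finset.univ.erase a) f (a := -a)
    (by simpa using (ne_neg_self a).symm)
  rw [h]
  linarith

theorem sum_apart_apart {a b : Idx n} (h : Apart a b) (f : Idx n → ℤ) :
    ∑ c with Apart c a ∧ Apart c b, f c = ∑ c with Apart c a, f c - f b - f (-b) := by
  have hab := apart_iff.1 h
  have hb0 := coe_ne_zero b
  have h0 : Finset.univ.filter (fun c : Idx n => Apart c a ∧ Apart c b) =
      ((Finset.univ.filter (fun c : Idx n => Apart c a)).erase b).erase (-b) := by
    ext c
    simp only [Finset.mem_filter, Finset.mem_univ, true_and, Finset.mem_erase]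
    constructor
    · rintro ⟨h1, h2, h3⟩; exact ⟨h3, h2, h1⟩
    · rintro ⟨h3, h2, h1⟩; exact ⟨h1, h2, h3⟩
  have h1 := Finset.sum_erase_add (Finset.univ.filter (fun c : Idx n => Apart c a)) f (a := b)
    (by simpa using h.symm)
  have h2 := Finset.sum_erase_add ((Finset.univ.filter (fun c : Idx n => Apart c a)).erase b) f
    (a := -b) (by
      simp only [Finset.mem_filter, Finset.mem_univ, true_and, Finset.mem_erase, apart_iff,
        coe_neg, Ne, idx_ext_iff]
      omega)
  rw [h0]
  linarith

theorem card_apart (a : Idx n) :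
    ((Finset.univ.filter (fun c : Idx n => Apart c a)).card : ℤ) = 2 * n - 2 := by
  have h := sum_apart a (fun _ => 1)
  simp only [Finset.sum_const, nsmul_eq_mul, mul_one, Finset.card_univ, card_idx] at h
  rw [h]
  push_cast
  ring

theorem card_apart_apart {a b : Idx n} (h : Apart a b) :
    ((Finset.univ.filter (fun c : Idx n => Apart c a ∧ Apart c b)).card : ℤ) = 2 * n - 4 := by
  have h := sum_apart_apart h (fun _ => 1)
  simp only [Finset.sum_const, nsmul_eq_mul, mul_one, card_apart] at h
  rw [h]
  ring

theorem eq_ref_of_mem_reflections {r : D n} (hr : r ∈ reflections n) {a : Idx n}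
    (ha : (r : Equiv.Perm (Idx n)) a ≠ a) :
    Apart ((r : Equiv.Perm (Idx n)) a) a ∧
      (r : Equiv.Perm (Idx n)) = ref a ((r : Equiv.Perm (Idx n)) a) := by
  obtain ⟨p, q, hpq, e⟩ := mem_reflections_iff.1 hr
  rw [e] at ha ⊢
  exact ⟨(ref_eq_of_apply_ne hpq ha).1.symm, (ref_eq_of_apply_ne hpq ha).2⟩

/-- A reflection moving `a` is determined by the image `c` of `a`, and every `c ≠ a, -a` occurs. -/
theorem sum_reflections_moving (a : Idx n) (G : Equiv.Perm (Idx n) → ℤ) :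
    ∑ r ∈ (reflections n).filter (fun r : D n => (r : Equiv.Perm (Idx n)) a ≠ a), G r =
      ∑ c with Apart c a, G (ref a c) := by
  refine Finset.sum_bij (fun r _ => (r : Equiv.Perm (Idx n)) a) ?_ ?_ ?_ ?_
  · intro r hr
    rw [Finset.mem_filter] at hr ⊢
    exact ⟨Finset.mem_univ _, (eq_ref_of_mem_reflections hr.1 hr.2).1⟩
  · intro r hr s hs hrs
    rw [Finset.mem_filter] at hr hs
    apply Subtype.ext
    rw [(eq_ref_of_mem_reflections hr.1 hr.2).2, (eq_ref_of_mem_reflections hs.1 hs.2).2, hrs]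
  · intro c hc
    rw [Finset.mem_filter] at hc
    refine ⟨⟨ref a c, ref_mem_D hc.2.symm⟩, ?_, ref_apply_left hc.2.symm⟩
    rw [Finset.mem_filter]
    refine ⟨mem_reflections_iff.2 ⟨a, c, hc.2.symm, rfl⟩, ?_⟩
    show ref a c a ≠ a
    rw [ref_apply_left hc.2.symm]
    exact hc.2.1
  · intro r hr
    rw [Finset.mem_filter] at hr
    exact congrArg G (eq_ref_of_mem_reflections hr.1 hr.2).2

theorem sum_reflections_fixing_moving {a b : Idx n} (hab : Apart a b)
    (G : Equiv.Perm (Idx n) → ℤ) :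
    ∑ r ∈ (reflections n).filter (fun r : D n =>
        (r : Equiv.Perm (Idx n)) a = a ∧ (r : Equiv.Perm (Idx n)) b ≠ b), G r =
      ∑ c with Apart c a ∧ Apart c b, G (ref b c) := by
  refine Finset.sum_bij (fun r _ => (r : Equiv.Perm (Idx n)) b) ?_ ?_ ?_ ?_
  · intro r hr
    rw [Finset.mem_filter] at hr ⊢
    refine ⟨Finset.mem_univ _, ?_, (eq_ref_of_mem_reflections hr.1 hr.2.2).1⟩
    have := hab.symm.map r.2.1
    rwa [hr.2.1] at this
  · intro r hr s hs hrs
    rw [Finset.mem_filter] at hr hs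
    apply Subtype.ext
    rw [(eq_ref_of_mem_reflections hr.1 hr.2.2).2, (eq_ref_of_mem_reflections hs.1 hs.2.2).2, hrs]
  · intro c hc
    rw [Finset.mem_filter] at hc
    obtain ⟨-, hca, hcb⟩ := hc
    refine ⟨⟨ref b c, ref_mem_D hcb.symm⟩, ?_, ref_apply_left hcb.symm⟩
    rw [Finset.mem_filter]
    refine ⟨mem_reflections_iff.2 ⟨b, c, hcb.symm, rfl⟩, ?_, ?_⟩
    · exact ref_apply_of_apart hcb.symm hab hca.symm
    · show ref b c b ≠ b
      rw [ref_apply_left hcb.symm]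
      exact hcb.1
  · intro r hr
    rw [Finset.mem_filter] at hr
    exact congrArg G (eq_ref_of_mem_reflections hr.1 hr.2.2).2

theorem card_moved {r : D n} (hr : r ∈ reflections n) :
    (Finset.univ.filter (fun a : Idx n => (r : Equiv.Perm (Idx n)) a ≠ a)).card = 4 := by
  obtain ⟨p, q, hpq, e⟩ := mem_reflections_iff.1 hr
  have hpq' := apart_iff.1 hpq
  have hp := coe_ne_zero p
  have hq := coe_ne_zero q
  have : Finset.univ.filter (fun a : Idx n => (r : Equiv.Perm (Idx n)) a ≠ a) =
      {p, q, -p, -q} := by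
    ext a
    simp only [e, Finset.mem_filter, Finset.mem_univ, true_and, Finset.mem_insert,
      Finset.mem_singleton, idx_ext_iff, coe_ref_apply hpq, coe_neg, Ne]
    split_ifs <;> omega
  rw [this, Finset.card_insert_of_notMem, Finset.card_insert_of_notMem, Finset.card_pair]
  all_goals
    simp only [Finset.mem_insert, Finset.mem_singleton, idx_ext_iff, coe_neg, Ne]
    omega

/-- Double count of the pairs `(r, a)` with `r a ≠ a`: each reflection moves 4 indices, and each of
the `2 n` indices is moved by `2 n - 2` reflections. -/
theorem card_reflections : ((reflections n).card : ℤ) = n * (n - 1) := by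
  have h : ∑ r ∈ reflections n, ∑ a : Idx n,
      (if (r : Equiv.Perm (Idx n)) a ≠ a then (1 : ℤ) else 0) = 4 * (reflections n).card := by
    rw [Finset.sum_congr rfl (g := fun _ => (4 : ℤ))]
    · simp [mul_comm]
    · intro r hr
      rw [Finset.sum_boole, card_moved hr]
      rfl
  rw [Finset.sum_comm] at h
  have h' : ∀ a : Idx n, ∑ r ∈ reflections n,
      (if (r : Equiv.Perm (Idx n)) a ≠ a then (1 : ℤ) else 0) = 2 * n - 2 := by
    intro a
    rw [← Finset.sum_filter, sum_reflections_moving a (fun _ => 1), ← card_apart a]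
    simp
  simp only [h', Finset.sum_const, nsmul_eq_mul, Finset.card_univ, card_idx] at h
  push_cast at h
  linarith

/-! ### The action of the reflections on `shrink` and on sign differences -/

/-- `a` shifted by one towards zero. -/
def shrink (a : Idx n) : ℤ := a - Int.sign a

theorem shrink_neg (a : Idx n) : shrink (-a) = -shrink a := by
  simp only [shrink, coe_neg, Int.sign_neg]
  ring

theorem sum_shrink : ∑ c : Idx n, shrink c = 0 := by
  have h : ∑ c : Idx n, shrink (-c) = ∑ c : Idx n, shrink c :=
    Equiv.sum_comp (⟨fun c => -c, fun c => -c, neg_neg_idx, neg_neg_idx⟩ : Idx n ≃ Idx n) shrink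
  simp only [shrink_neg, Finset.sum_neg_distrib] at h
  linarith

/-- In the full interval `n - b` integers lie above `b` and `n + b` below; the term `sign b`
corrects for the missing index 0. -/
theorem sum_sign_sub (b : Idx n) :
    ∑ c : Idx n, Int.sign ((c : ℤ) - b) = Int.sign b - 2 * b := by
  obtain ⟨h1, h2, h3⟩ := idx_bounds b
  have hs : ∀ x : ℤ, Int.sign (x - b) = (if (b : ℤ) < x then 1 else 0) - if x < b then 1 else 0 := by
    intro x
    rcases lt_trichotomy x b with h | h | h
    · rw [Int.sign_eq_neg_one_of_neg (by omega), if_neg (by omega), if_pos h]; rfl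
    · simp [h]
    · rw [Int.sign_eq_one_of_pos (by omega), if_pos h, if_neg (by omega)]; rfl
  rw [sum_idx (fun x => Int.sign (x - b)), zero_sub, Int.sign_neg]
  simp only [hs]
  rw [Finset.sum_sub_distrib, Finset.sum_boole, Finset.sum_boole]
  have e1 : (Finset.Icc (-(n : ℤ)) n).filter (fun x => (b : ℤ) < x) = Finset.Ioc (b : ℤ) n := by
    ext x
    simp only [Finset.mem_filter, Finset.mem_Icc, Finset.mem_Ioc]
    omega
  have e2 : (Finset.Icc (-(n : ℤ)) n).filter (fun x => x < (b : ℤ)) =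
      Finset.Ico (-(n : ℤ)) b := by
    ext x
    simp only [Finset.mem_filter, Finset.mem_Icc, Finset.mem_Ico]
    omega
  rw [e1, e2, Int.card_Ioc, Int.card_Ico, Int.toNat_of_nonneg (by omega), Int.toNat_of_nonneg (by omega)]
  ring

/-- This is the origin of `shrink`: omitting 0 and omitting `-b` each contribute `sign b` to `-2 b`.
-/
theorem sum_apart_sign_sub (b : Idx n) :
    ∑ c with Apart c b, Int.sign ((c : ℤ) - b) = -2 * shrink b := by
  rw [sum_apart b (fun c => Int.sign ((c : ℤ) - b)), sum_sign_sub, sub_self, coe_neg, shrink,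
    show -(b : ℤ) - b = -(2 * b) by ring, Int.sign_neg, Int.sign_mul, Int.sign_zero,
    show Int.sign 2 = 1 from rfl]
  ring

/-- The `2 n - 2` reflections moving `a` send it to all `c ≠ a, -a`; as `shrink` is odd, these
images contribute 0, while all other reflections contribute `shrink a`. -/
theorem sum_reflections_shrink (a : Idx n) :
    ∑ r ∈ reflections n, shrink ((r : Equiv.Perm (Idx n)) a) =
      (n - 1) * (n - 2) * shrink a := by
  have h : ∑ r ∈ reflections n, (shrink ((r : Equiv.Perm (Idx n)) a) - shrink a) =
      -(2 * n - 2) * shrink a := by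
    rw [← Finset.sum_filter_add_sum_filter_not _
      (fun r : D n => (r : Equiv.Perm (Idx n)) a ≠ a),
      sum_reflections_moving a (fun w => shrink (w a) - shrink a),
      Finset.sum_eq_zero (s := (reflections n).filter (fun r => ¬ _))]
    · rw [Finset.sum_congr rfl (g := fun c => shrink c - shrink a)]
      · rw [Finset.sum_sub_distrib, sum_apart, sum_shrink, shrink_neg, Finset.sum_const,
          nsmul_eq_mul, card_apart]
        ring
      · intro c hc
        rw [Finset.mem_filter] at hc
        rw [ref_apply_left hc.2.symm]
    · intro r hr
      rw [Finset.mem_filter, not_not] at hr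
      rw [hr.2, sub_self]
  rw [Finset.sum_sub_distrib, Finset.sum_const, nsmul_eq_mul, card_reflections] at h
  linarith

/-- Only the change from `s` is summed. `hA` covers the reflections moving `a` to some `c ≠ b, -b`,
and `hB` those fixing `a` and moving `b`; their terms `sign (-a - b)` cancel. The drift `2 (shrink a
- shrink b)` comes from `sum_apart_sign_sub`. -/
theorem sum_reflections_sign_sub {a b : Idx n} (hab : Apart a b) :
    ∑ r ∈ reflections n, Int.sign ((((r : Equiv.Perm (Idx n)) a : Idx n) : ℤ) -
        ((r : Equiv.Perm (Idx n)) b : Idx n)) =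
      (n - 1) * (n - 4) * Int.sign ((a : ℤ) - b) + 2 * (shrink a - shrink b) := by
  set s : ℤ := Int.sign ((a : ℤ) - b) with hs
  have hs' : Int.sign ((b : ℤ) - a) = -s := by rw [hs, ← Int.sign_neg, neg_sub]
  have hnab : Apart (-b) a := by
    have := apart_iff.1 hab
    rw [apart_iff, coe_neg]
    omega
  have hA : ∑ c with Apart c a ∧ Apart c b, (Int.sign ((c : ℤ) - b) - s) =
      -2 * shrink b - Int.sign ((a : ℤ) - b) - Int.sign (-(a : ℤ) - b) - (2 * n - 4) * s := by
    rw [Finset.sum_sub_distrib, Finset.sum_const, nsmul_eq_mul, card_apart_apart hab]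
    simp only [and_comm (a := Apart _ a)]
    rw [sum_apart_apart hab.symm, sum_apart_sign_sub, coe_neg]
  have hB : ∑ c with Apart c a ∧ Apart c b, (Int.sign ((a : ℤ) - c) - s) =
      2 * shrink a - Int.sign ((a : ℤ) - b) + Int.sign (-(a : ℤ) - b) - (2 * n - 4) * s := by
    rw [Finset.sum_sub_distrib, Finset.sum_const, nsmul_eq_mul, card_apart_apart hab]
    have : ∀ c : Idx n, Int.sign ((a : ℤ) - c) = -Int.sign ((c : ℤ) - a) := by
      intro c
      rw [← Int.sign_neg, neg_sub]
    simp only [this, Finset.sum_neg_distrib]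
    rw [sum_apart_apart hab, sum_apart_sign_sub, coe_neg, hs',
      show -(b : ℤ) - a = -(a : ℤ) - b by ring]
    ring
  -- The case `c = b` flips the sign and contributes `-2 s`; the case `c = -b` sends `(a, b)` to
  -- `(-b, -a)` and changes nothing.
  have hC : ∑ c with Apart c a, (Int.sign (((ref a c a : Idx n) : ℤ) - (ref a c b : Idx n)) - s) =
      ∑ c with Apart c a ∧ Apart c b, (Int.sign ((c : ℤ) - b) - s) - 2 * s := by
    have e := sum_apart_apart hab
      (fun c => Int.sign (((ref a c a : Idx n) : ℤ) - (ref a c b : Idx n)) - s)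
    rw [ref_apply_left hab, ref_apply_right hab, hs', ref_apply_left hnab.symm] at e
    have e1 : ref a (-b) b = -a := by
      have := isSigned_ref hnab.symm (-b)
      rwa [neg_neg_idx, ref_apply_right hnab.symm] at this
    rw [e1, coe_neg, coe_neg, show -(b : ℤ) - -(a : ℤ) = a - b by ring, ← hs] at e
    rw [Finset.sum_congr rfl (g := fun c : Idx n => Int.sign ((c : ℤ) - b) - s)] at e
    · linarith
    · intro c hc
      simp only [Finset.mem_filter, Finset.mem_univ, true_and] at hc
      rw [ref_apply_left hc.1.symm, ref_apply_of_apart hc.1.symm hab.symm hc.2.symm]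
  have h : ∑ r ∈ reflections n, (Int.sign ((((r : Equiv.Perm (Idx n)) a : Idx n) : ℤ) -
        ((r : Equiv.Perm (Idx n)) b : Idx n)) - s) =
      -(4 * (n - 1)) * s + 2 * (shrink a - shrink b) := by
    rw [← Finset.sum_filter_add_sum_filter_not _
      (fun r : D n => (r : Equiv.Perm (Idx n)) a ≠ a),
      sum_reflections_moving a (fun w => Int.sign (((w a : Idx n) : ℤ) - (w b : Idx n)) - s), hC,
      ← Finset.sum_filter_add_sum_filter_not ((reflections n).filter (fun r => ¬ _))
        (fun r : D n => (r : Equiv.Perm (Idx n)) b ≠ b)]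
    simp only [Finset.filter_filter, not_not]
    rw [sum_reflections_fixing_moving hab
        (fun w => Int.sign (((w a : Idx n) : ℤ) - (w b : Idx n)) - s), hA,
      Finset.sum_congr rfl (g := fun c : Idx n => Int.sign ((a : ℤ) - c) - s), hB, ← hs,
      Finset.sum_eq_zero]
    · ring
    · intro r hr
      rw [Finset.mem_filter] at hr
      rw [hr.2.1, hr.2.2, ← hs, sub_self]
    · intro c hc
      simp only [Finset.mem_filter, Finset.mem_univ, true_and] at hc
      rw [ref_apply_left hc.2.symm, ref_apply_of_apart hc.2.symm hab hc.1.symm]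
  rw [Finset.sum_sub_distrib, Finset.sum_const, nsmul_eq_mul, card_reflections] at h
  linarith

theorem sum_shrink_sq : 3 * ∑ c : Idx n, shrink c ^ 2 = n * (n - 1) * (2 * n - 1) := by
  have h : ∀ m : ℕ, 3 * ∑ k ∈ Finset.Icc (-(m : ℤ)) m, (k - Int.sign k) ^ 2 =
      m * (m - 1) * (2 * m - 1) := by
    intro m
    induction m with
    | zero => simp
    | succ m ih =>
      have e : Finset.Icc (-((m + 1 : ℕ) : ℤ)) (m + 1 : ℕ) =
          insert ((m : ℤ) + 1) (insert (-((m : ℤ) + 1)) (Finset.Icc (-(m : ℤ)) m)) := by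
        ext x
        simp only [Finset.mem_insert, Finset.mem_Icc]
        omega
      have hp : Int.sign ((m : ℤ) + 1) = 1 := Int.sign_eq_one_of_pos (by omega)
      rw [e, Finset.sum_insert, Finset.sum_insert, Int.sign_neg, hp, mul_add, mul_add, ih]
      · push_cast
        ring
      · rw [Finset.mem_Icc]; omega
      · rw [Finset.mem_insert, Finset.mem_Icc]; omega
  have := sum_idx (n := n) (fun k => (k - Int.sign k) ^ 2)
  simp only [Int.sign_zero, sub_zero, ne_eq, OfNat.ofNat_ne_zero, not_false_eq_true, zero_pow]
    at this
  rw [← h n, ← this]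
  rfl

/-! ### Coxeter length as half the number of inversions -/

/-- The pairs `(p, q)` with `p < q` and `p ≠ -q`: each positive root occurs twice. -/
noncomputable def rootPairs (n : ℕ) : Finset (Idx n × Idx n) :=
  Finset.univ.filter (fun x => Apart x.1 x.2 ∧ (x.1 : ℤ) < x.2)

/-- The root pairs whose order is reversed by `w`. -/
noncomputable def inversions (w : Equiv.Perm (Idx n)) : Finset (Idx n × Idx n) :=
  (rootPairs n).filter (fun x => (w x.2 : ℤ) < w x.1)

theorem mem_inversions {w : Equiv.Perm (Idx n)} {x : Idx n × Idx n} :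
    x ∈ inversions w ↔ Apart x.1 x.2 ∧ (x.1 : ℤ) < x.2 ∧ (w x.2 : ℤ) < w x.1 := by
  simp [inversions, rootPairs, and_assoc]

theorem inversions_one : inversions (1 : Equiv.Perm (Idx n)) = ∅ := by
  ext x
  simp only [mem_inversions, Equiv.Perm.coe_one, id, Finset.notMem_empty, iff_false]
  omega

/-- `ref a b` exchanges two values that are adjacent, or adjacent up to their negatives. -/
def Adjacent (a b : Idx n) : Prop := (b : ℤ) = a + 1 ∨ ((a : ℤ) = -1 ∧ (b : ℤ) = 2)

theorem adjacent_apart {a b : Idx n} (h : Adjacent a b) : Apart a b := by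
  have := coe_ne_zero a
  have := coe_ne_zero b
  rw [apart_iff]
  rcases h with h | h <;> omega

theorem ref_lt_ref {a b : Idx n} (h : Adjacent a b) {p q : Idx n}
    (hpq : Apart p q) (hlt : (p : ℤ) < q) (h1 : ¬ ((p : ℤ) = a ∧ (q : ℤ) = b))
    (h2 : ¬ ((p : ℤ) = -b ∧ (q : ℤ) = -a)) : (ref a b p : ℤ) < ref a b q := by
  have hap := adjacent_apart h
  have ha0 := coe_ne_zero a
  have hb0 := coe_ne_zero b
  have hp0 := coe_ne_zero p
  have hq0 := coe_ne_zero q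
  rw [coe_ref_apply hap, coe_ref_apply hap]
  rw [apart_iff] at hpq
  rcases h with h | h <;> split_ifs <;> omega

/-- `ref a b` permutes the root pairs other than `(a, b)` and `(-b, -a)`, which represent its own
root, so only these two stop being inversions. -/
theorem card_inversions_mul_ref {a b : Idx n} (h : Adjacent a b)
    {w : Equiv.Perm (Idx n)} (hw : IsSigned w) (hlt : (w b : ℤ) < w a) :
    (inversions w).card = (inversions (w * ref a b)).card + 2 := by
  have hap := adjacent_apart h
  have ha0 := coe_ne_zero a
  have hb0 := coe_ne_zero b
  have hne : (a, b) ≠ (-b, -a) := by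
    intro e
    have := congrArg (fun x : Idx n × Idx n => (x.1 : ℤ)) e
    have := apart_iff.1 hap
    simp only [coe_neg] at *
    omega
  have hab : (a : ℤ) < b := by rcases h with h | h <;> omega
  have hnap : Apart (-b) (-a) := by rw [apart_iff] at *; simp only [coe_neg]; omega
  have hsub : ({(a, b), (-b, -a)} : Finset (Idx n × Idx n)) ⊆ inversions w := by
    intro x hx
    rw [Finset.mem_insert, Finset.mem_singleton] at hx
    rw [mem_inversions]
    rcases hx with rfl | rfl
    · exact ⟨hap, hab, hlt⟩
    · refine ⟨hnap, ?_, ?_⟩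
      · simp only [coe_neg]; omega
      · rw [hw, hw, coe_neg, coe_neg]; omega
  have hcard : (inversions w \ {(a, b), (-b, -a)}).card = (inversions (w * ref a b)).card := by
    have hinv : ∀ x, ref a b (ref a b x) = x := fun x => by
      rw [← Equiv.Perm.mul_apply, ref_mul_self hap, Equiv.Perm.coe_one, id]
    refine Finset.card_nbij' (fun x => (ref a b x.1, ref a b x.2))
      (fun x => (ref a b x.1, ref a b x.2)) ?_ ?_ ?_ ?_
    · rintro ⟨p, q⟩ hx
      simp only [Finset.coe_sdiff, Set.mem_sdiff, Finset.mem_coe, mem_inversions,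
        Finset.mem_insert, Finset.mem_singleton, Prod.mk.injEq, idx_ext_iff, coe_neg,
        not_or] at hx ⊢
      obtain ⟨⟨h1, h2, h3⟩, h4, h5⟩ := hx
      refine ⟨h1.map (isSigned_ref hap), ref_lt_ref h h1 h2 h4 h5, ?_⟩
      rw [Equiv.Perm.mul_apply, Equiv.Perm.mul_apply, hinv, hinv]
      exact h3
    · rintro ⟨p, q⟩ hx
      simp only [Finset.coe_sdiff, Set.mem_sdiff, Finset.mem_coe, mem_inversions,
        Finset.mem_insert, Finset.mem_singleton, Prod.mk.injEq, Equiv.Perm.mul_apply] at hx ⊢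
      obtain ⟨h1, h2, h3⟩ := hx
      have n1 : ¬ (p = a ∧ q = b) := by
        rintro ⟨rfl, rfl⟩
        rw [ref_apply_left hap, ref_apply_right hap] at h3
        omega
      have n2 : ¬ (p = -b ∧ q = -a) := by
        rintro ⟨rfl, rfl⟩
        rw [isSigned_ref hap, isSigned_ref hap, ref_apply_left hap, ref_apply_right hap, hw, hw,
          coe_neg, coe_neg] at h3
        omega
      simp only [idx_ext_iff, coe_neg] at n1 n2
      have hl := ref_lt_ref h h1 h2 n1 n2
      refine ⟨⟨h1.map (isSigned_ref hap), hl, h3⟩, ?_⟩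
      rintro (⟨e1, e2⟩ | ⟨e1, e2⟩)
      · have e1' := hinv p
        have e2' := hinv q
        rw [e1, ref_apply_left hap] at e1'
        rw [e2, ref_apply_right hap] at e2'
        rw [← e1', ← e2'] at h2
        omega
      · have e1' := hinv p
        have e2' := hinv q
        rw [e1, isSigned_ref hap, ref_apply_right hap] at e1'
        rw [e2, isSigned_ref hap, ref_apply_left hap] at e2'
        rw [← e1', ← e2', coe_neg, coe_neg] at h2
        omega
    · rintro ⟨p, q⟩ _
      simp only [hinv]
    · rintro ⟨p, q⟩ _
      simp only [hinv]
  rw [← hcard, Finset.card_sdiff_of_subset hsub, Finset.card_pair hne]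
  have := Finset.card_le_card hsub
  rw [Finset.card_pair hne] at this
  omega

/-- The exceptional generator is `ref (-1) 2`, which lets all generators be treated alike; `-1 ≤ a`
discards the negated descriptions. -/
theorem mem_simpleReflections_iff {s : D n} : s ∈ simpleReflections n ↔
    ∃ a b : Idx n, (-1 : ℤ) ≤ a ∧ Adjacent a b ∧ (s : Equiv.Perm (Idx n)) = ref a b := by
  constructor
  · rintro (⟨i, j, hi, hj, e⟩ | ⟨i, j, hi, hj, e⟩)
    · exact ⟨i, j, by omega, Or.inl hj, e⟩
    · refine ⟨-i, j, by rw [coe_neg]; omega, Or.inr ⟨by rw [coe_neg, hi], hj⟩, ?_⟩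
      have hap : Apart i (-j) := by rw [apart_iff, coe_neg]; omega
      rw [← neg_neg_idx j, ref_neg_neg hap, e, ref]
      simp only [neg_neg_idx]
  · rintro ⟨a, b, ha, h, e⟩
    have ha0 := coe_ne_zero a
    have hb0 := coe_ne_zero b
    rcases h with h | ⟨h1, h2⟩
    · exact Or.inl ⟨a, b, by omega, h, e⟩
    · refine Or.inr ⟨-a, b, by rw [coe_neg, h1]; rfl, h2, ?_⟩
      have hap : Apart a b := by rw [apart_iff]; omega
      rw [e, ← ref_neg_neg hap, ref, neg_neg_idx b]

theorem card_inversions_mul_le {s : D n} (hs : s ∈ simpleReflections n) (w : D n) :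
    (inversions ((w * s : D n) : Equiv.Perm (Idx n))).card ≤
      (inversions (w : Equiv.Perm (Idx n))).card + 2 := by
  obtain ⟨a, b, ha, h, e⟩ := mem_simpleReflections_iff.1 hs
  have hap := adjacent_apart h
  rw [Subgroup.coe_mul, e]
  rcases lt_or_ge (((w : Equiv.Perm (Idx n)) b : Idx n) : ℤ)
    ((w : Equiv.Perm (Idx n)) a : Idx n) with hlt | hge
  · have := card_inversions_mul_ref h w.2.1 hlt
    omega
  · have hne := (apart_iff.1 (hap.map w.2.1)).1
    have := card_inversions_mul_ref h (w.2.1.mul (isSigned_ref hap))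
      (by
        rw [Equiv.Perm.mul_apply, Equiv.Perm.mul_apply, ref_apply_left hap, ref_apply_right hap]
        omega)
    rw [mul_assoc, ref_mul_self hap, mul_one] at this
    omega

theorem card_inversions_prod_le (l : List (D n)) (hl : ∀ s ∈ l, s ∈ simpleReflections n) :
    (inversions (l.prod : Equiv.Perm (Idx n))).card ≤ 2 * l.length := by
  induction l using List.reverseRecOn with
  | nil => simp [inversions_one]
  | append_singleton l s ih =>
    rw [List.prod_append, List.prod_singleton, List.length_append, List.length_singleton]
    have h1 := card_inversions_mul_le (hl s (by simp)) l.prod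
    have h2 := ih (fun x hx => hl x (by simp [hx]))
    omega

/-- The absence of descents makes `w` increasing on positive indices and positive above 1; parity
then gives `w 1 > 0`, so `w` is increasing everywhere. -/
theorem eq_one_of_no_descent {w : D n} (h : ∀ a b : Idx n, (-1 : ℤ) ≤ a → Adjacent a b →
    (((w : Equiv.Perm (Idx n)) a : Idx n) : ℤ) < ((w : Equiv.Perm (Idx n)) b : Idx n)) :
    w = 1 := by
  have hmono : ∀ m : ℕ, ∀ a b : Idx n, 0 < (a : ℤ) → (b : ℤ) = a + 1 + m →
      (((w : Equiv.Perm (Idx n)) a : Idx n) : ℤ) < ((w : Equiv.Perm (Idx n)) b : Idx n) := by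
    intro m
    induction m with
    | zero =>
      intro a b ha hb
      exact h a b (by omega) (Or.inl (by simpa using hb))
    | succ m ih =>
      intro a b ha hb
      have hbb := idx_bounds b
      let c : Idx n := mkIdx (b - 1) (by push_cast at hb; omega)
      have hc : (c : ℤ) = b - 1 := rfl
      have h1 := ih a c ha (by push_cast at hb; omega)
      have h2 := h c b (by push_cast at hb; omega) (Or.inl (by omega))
      omega
  have hmono' : ∀ a b : Idx n, 0 < (a : ℤ) → (a : ℤ) < b →
      (((w : Equiv.Perm (Idx n)) a : Idx n) : ℤ) < ((w : Equiv.Perm (Idx n)) b : Idx n) :=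
    fun a b ha hab => hmono ((b : ℤ) - a - 1).toNat a b ha (by omega)
  have hpos2 : ∀ a : Idx n, 1 < (a : ℤ) → 0 < (((w : Equiv.Perm (Idx n)) a : Idx n) : ℤ) := by
    intro a ha
    have hab := idx_bounds a
    let e : Idx n := mkIdx 1 (by omega)
    let t : Idx n := mkIdx 2 (by omega)
    -- Together the two conditions say `|w 1| < w 2`.
    have h1 := h (-e) t (by rw [coe_neg]; exact le_refl _) (Or.inr ⟨rfl, rfl⟩)
    have h2 := h e t (by show (-1 : ℤ) ≤ 1; omega) (Or.inl rfl)
    rw [w.2.1, coe_neg] at h1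
    have h3 : (((w : Equiv.Perm (Idx n)) t : Idx n) : ℤ) ≤ ((w : Equiv.Perm (Idx n)) a : Idx n) := by
      rcases eq_or_ne t a with e | e
      · rw [e]
      · have : (t : ℤ) = 2 := rfl
        rw [Ne, idx_ext_iff] at e
        exact (hmono' t a (by omega) (by omega)).le
    omega
  have hpos : ∀ a : Idx n, 0 < (a : ℤ) → 0 < (((w : Equiv.Perm (Idx n)) a : Idx n) : ℤ) := by
    intro a ha
    by_contra hneg
    have ha1 : (a : ℤ) = 1 := by
      by_contra hne
      exact hneg (hpos2 a (by omega))
    -- A negative value at 1 would be the only one, against evenness.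
    have hn : negatives (w : Equiv.Perm (Idx n)) = {a} := by
      ext x
      simp only [negatives, Finset.mem_filter, Finset.mem_univ, true_and, Finset.mem_singleton]
      constructor
      · rintro ⟨hx, hx'⟩
        by_contra hne
        rw [idx_ext_iff] at hne
        have := hpos2 x (by omega)
        omega
      · rintro rfl
        have := coe_ne_zero ((w : Equiv.Perm (Idx n)) x)
        exact ⟨ha, by omega⟩
    have := w.2.2
    rw [hn] at this
    simp at this
  have hsm : StrictMono (w : Equiv.Perm (Idx n)) := by
    intro a b hab
    have hab' : (a : ℤ) < b := hab
    show (((w : Equiv.Perm (Idx n)) a : Idx n) : ℤ) < ((w : Equiv.Perm (Idx n)) b : Idx n)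
    have ha0 := coe_ne_zero a
    have hb0 := coe_ne_zero b
    rcases lt_or_gt_of_ne ha0 with ha | ha
    · have h1 := hpos (-a) (by rw [coe_neg]; omega)
      rw [w.2.1, coe_neg] at h1
      rcases lt_or_gt_of_ne hb0 with hb | hb
      · have h2 := hmono' (-b) (-a) (by rw [coe_neg]; omega) (by rw [coe_neg, coe_neg]; omega)
        rw [w.2.1, w.2.1, coe_neg, coe_neg] at h2
        omega
      · have h2 := hpos b hb
        omega
    · exact hmono' a b ha hab'
  -- A finite linear order has no automorphism but the identity.
  have hiso := Subsingleton.elim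
    (hsm.orderIsoOfSurjective _ (w : Equiv.Perm (Idx n)).surjective) (OrderIso.refl (Idx n))
  apply Subtype.ext
  ext x
  have := congrArg (fun e : Idx n ≃o Idx n => ((e x : Idx n) : ℤ)) hiso
  exact this

/-- Right multiplication by a simple reflection at a descent removes exactly two inversions; without
descents `w = 1`. -/
theorem exists_reduced_word (m : ℕ) : ∀ w : D n,
    (inversions (w : Equiv.Perm (Idx n))).card ≤ m →
    ∃ l : List (D n), (∀ s ∈ l, s ∈ simpleReflections n) ∧
      2 * l.length = (inversions (w : Equiv.Perm (Idx n))).card ∧ l.prod = w := by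
  induction m with
  | zero =>
    intro w hw
    refine ⟨[], by simp, by simpa using (Nat.le_zero.1 hw).symm, ?_⟩
    rw [List.prod_nil, eq_comm]
    refine eq_one_of_no_descent fun a b ha h => ?_
    by_contra hlt
    have hap := adjacent_apart h
    have hne := (apart_iff.1 (hap.map w.2.1)).1
    have := card_inversions_mul_ref h w.2.1 (by omega)
    omega
  | succ m ih =>
    intro w hw
    by_cases hd : ∀ a b : Idx n, (-1 : ℤ) ≤ a → Adjacent a b →
      (((w : Equiv.Perm (Idx n)) a : Idx n) : ℤ) < ((w : Equiv.Perm (Idx n)) b : Idx n)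
    · refine ⟨[], by simp, ?_, ?_⟩
      · rw [eq_one_of_no_descent hd, OneMemClass.coe_one, inversions_one]
        simp
      · rw [eq_one_of_no_descent hd, List.prod_nil]
    · push Not at hd
      obtain ⟨a, b, ha, h, hle⟩ := hd
      have hap := adjacent_apart h
      have hne := (apart_iff.1 (hap.map w.2.1)).1
      have hc := card_inversions_mul_ref h w.2.1 (by omega)
      let s : D n := ⟨ref a b, ref_mem_D hap⟩
      have hs : s ∈ simpleReflections n := mem_simpleReflections_iff.2 ⟨a, b, ha, h, rfl⟩
      have hc' : (inversions (w : Equiv.Perm (Idx n))).card =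
        (inversions ((w * s : D n) : Equiv.Perm (Idx n))).card + 2 := hc
      obtain ⟨l, hl, hlen, hprod⟩ := ih (w * s) (by omega)
      refine ⟨l ++ [s], ?_, ?_, ?_⟩
      · intro x hx
        rw [List.mem_append, List.mem_singleton] at hx
        rcases hx with hx | rfl
        · exact hl x hx
        · exact hs
      · rw [List.length_append, List.length_singleton]
        omega
      · rw [List.prod_append, List.prod_singleton, hprod, mul_assoc,
          show s * s = 1 from Subtype.ext (ref_mul_self hap), mul_one]

theorem two_mul_length (w : D n) :
    2 * length n w = (inversions (w : Equiv.Perm (Idx n))).card := by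
  obtain ⟨l, hl, hlen, hprod⟩ := exists_reduced_word _ w le_rfl
  have : length n w = l.length := by
    refine wordLength_eq ⟨l, hl, rfl, hprod⟩ fun l' hl' hp => ?_
    have := card_inversions_prod_le l' hl'
    rw [hp] at this
    omega
  rw [this, hlen]

/-! ### Sums over the root pairs -/

theorem sum_shrink_sub_of_rootPairs :
    ∑ x ∈ rootPairs n, (shrink x.2 - shrink x.1) = 2 * ∑ c : Idx n, shrink c ^ 2 := by
  have h1 : ∀ x : Idx n × Idx n, (if Apart x.1 x.2 then
      shrink x.2 * Int.sign ((x.2 : ℤ) - x.1) else 0) =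
      (if Apart x.1 x.2 ∧ (x.1 : ℤ) < x.2 then shrink x.2 else 0) -
        (if Apart x.1 x.2 ∧ (x.2 : ℤ) < x.1 then shrink x.2 else 0) := by
    intro x
    by_cases hx : Apart x.1 x.2
    · rcases lt_or_gt_of_ne (apart_iff.1 hx).1 with h | h
      · rw [Int.sign_eq_one_of_pos (by omega), if_pos hx, if_pos ⟨hx, h⟩,
          if_neg fun h' => absurd h'.2 h.le.not_gt]
        ring
      · rw [Int.sign_eq_neg_one_of_neg (by omega), if_pos hx,
          if_neg fun h' => absurd h'.2 h.le.not_gt, if_pos ⟨hx, h⟩]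
        ring
    · simp [hx]
  have h2 : ∑ x : Idx n × Idx n, (if Apart x.1 x.2 ∧ (x.2 : ℤ) < x.1 then shrink x.2 else 0) =
      ∑ x ∈ rootPairs n, shrink x.1 := by
    rw [← Equiv.sum_comp (Equiv.prodComm (Idx n) (Idx n)), rootPairs, Finset.sum_filter]
    simp only [Equiv.prodComm_apply, Prod.fst_swap, Prod.snd_swap, apart_comm]
  -- The same signed sum over unordered pairs is evaluated by fixing `x.2` and summing the signs
  -- over `x.1`.
  have h3 : ∑ x : Idx n × Idx n, (if Apart x.1 x.2 then
      shrink x.2 * Int.sign ((x.2 : ℤ) - x.1) else 0) = 2 * ∑ c : Idx n, shrink c ^ 2 := by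
    rw [Fintype.sum_prod_type_right, Finset.mul_sum]
    refine Finset.sum_congr rfl fun b _ => ?_
    have hs : ∀ c : Idx n, Int.sign ((b : ℤ) - c) = -Int.sign ((c : ℤ) - b) := by
      intro c
      rw [← Int.sign_neg, neg_sub]
    simp only [hs]
    rw [← Finset.sum_filter, ← Finset.mul_sum, Finset.sum_neg_distrib, sum_apart_sign_sub]
    ring
  simp only [h1] at h3
  rw [Finset.sum_sub_distrib, h2, ← Finset.sum_filter] at h3
  rw [Finset.sum_sub_distrib, ← h3, rootPairs]

theorem card_rootPairs : ((rootPairs n).card : ℤ) = 2 * n * (n - 1) := by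
  have h1 : ∀ x : Idx n × Idx n, (if Apart x.1 x.2 then (1 : ℤ) else 0) =
      (if Apart x.1 x.2 ∧ (x.1 : ℤ) < x.2 then 1 else 0) +
        (if Apart x.1 x.2 ∧ (x.2 : ℤ) < x.1 then 1 else 0) := by
    intro x
    by_cases hx : Apart x.1 x.2
    · rcases lt_or_gt_of_ne (apart_iff.1 hx).1 with h | h
      · rw [if_pos hx, if_pos ⟨hx, h⟩, if_neg fun h' => absurd h'.2 h.le.not_gt, add_zero]
      · rw [if_pos hx, if_neg fun h' => absurd h'.2 h.le.not_gt, if_pos ⟨hx, h⟩, zero_add]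
    · simp [hx]
  have h2 : ∑ x : Idx n × Idx n, (if Apart x.1 x.2 ∧ (x.2 : ℤ) < x.1 then (1 : ℤ) else 0) =
      (rootPairs n).card := by
    rw [← Equiv.sum_comp (Equiv.prodComm (Idx n) (Idx n)), rootPairs, Finset.sum_boole]
    simp only [Equiv.prodComm_apply, Prod.fst_swap, Prod.snd_swap]
    simp only [apart_comm]
  have h3 : ∑ x : Idx n × Idx n, (if Apart x.1 x.2 then (1 : ℤ) else 0) =
      2 * n * (2 * n - 2) := by
    rw [Fintype.sum_prod_type_right]
    simp only [Finset.sum_boole]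
    simp only [card_apart, Finset.sum_const, Finset.card_univ, card_idx, nsmul_eq_mul]
    push_cast
    ring
  simp only [h1] at h3
  rw [Finset.sum_add_distrib, h2, Finset.sum_boole] at h3
  have : (Finset.univ.filter (fun x : Idx n × Idx n => Apart x.1 x.2 ∧ (x.1 : ℤ) < x.2)).card =
      (rootPairs n).card := rfl
  rw [this] at h3
  linarith

/-! ### Expectations of the eigenfunctions and the two formulas -/

/-- The average of `G` over products of `t` elements of `R`. -/
noncomputable def avg {M : Type*} [Monoid M] (R : Finset M) (t : ℕ) (G : M → ℝ) : ℝ :=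
  (∑ r ∈ Fintype.piFinset (fun _ : Fin t => R), G (List.ofFn r).prod) / (R.card : ℝ) ^ t

theorem avg_add {M : Type*} [Monoid M] (R : Finset M) (t : ℕ) (G H : M → ℝ) :
    avg R t (fun m => G m + H m) = avg R t G + avg R t H := by
  rw [avg, Finset.sum_add_distrib, add_div, avg, avg]

theorem avg_const_mul {M : Type*} [Monoid M] (R : Finset M) (t : ℕ) (c : ℝ) (G : M → ℝ) :
    avg R t (fun m => c * G m) = c * avg R t G := by
  rw [avg, ← Finset.mul_sum, mul_div_assoc, avg]

theorem avg_sum {M ι : Type*} [Monoid M] (R : Finset M) (t : ℕ) (s : Finset ι)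
    (G : ι → M → ℝ) : avg R t (fun m => ∑ i ∈ s, G i m) = ∑ i ∈ s, avg R t (G i) := by
  simp only [avg]
  rw [Finset.sum_comm, Finset.sum_div]

theorem avg_of_eigen {M : Type*} [Monoid M] {R : Finset M} (hR : (R.card : ℝ) ≠ 0) (t : ℕ)
    (G : M → ℝ) (c : ℝ) (h : ∀ m, ∑ r ∈ R, G (r * m) = R.card * c * G m) :
    avg R t G = c ^ t * G 1 := by
  rw [avg, sum_prod_ofFn_of_eigen R G _ h, mul_pow]
  field_simp

theorem expectedLength_eq_avg {M : Type*} [Monoid M] (R : Finset M) (φ : M → ℕ) (t : ℕ) :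
    expectedLength R φ t = avg R t (fun m => (φ m : ℝ)) := by
  rw [expectedLength, avg, one_div_mul_eq_div]

theorem productProb_eq_avg {M : Type*} [Monoid M] (R : Finset M) (t : ℕ) (P : M → Prop)
    [DecidablePred P] : productProb R t P = avg R t (fun m => if P m then 1 else 0) := by
  rw [productProb, avg, Finset.sum_boole]
  congr!

theorem cast_card_reflections : ((reflections n).card : ℝ) = n * (n - 1) := by
  exact_mod_cast congrArg (Int.cast : ℤ → ℝ) card_reflections

theorem avg_shrink_sub (hn : 2 ≤ n) (t : ℕ) (i j : Idx n) :
    avg (reflections n) t (fun w => ((shrink ((w : Equiv.Perm (Idx n)) i) -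
        shrink ((w : Equiv.Perm (Idx n)) j) : ℤ) : ℝ)) =
      (1 - 2 / (n : ℝ)) ^ t * ((shrink i - shrink j : ℤ) : ℝ) := by
  have hn' : (2 : ℝ) ≤ n := by exact_mod_cast hn
  have hn0 : (n : ℝ) ≠ 0 := by positivity
  have hn1 : (n : ℝ) - 1 ≠ 0 := by linarith
  rw [avg_of_eigen (by rw [cast_card_reflections]; positivity) t _ (1 - 2 / (n : ℝ))]
  · rfl
  · intro w
    have h := congrArg₂ (· - ·) (sum_reflections_shrink ((w : Equiv.Perm (Idx n)) i))
      (sum_reflections_shrink ((w : Equiv.Perm (Idx n)) j))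
    simp only [← Finset.sum_sub_distrib] at h
    have h' := congrArg (Int.cast : ℤ → ℝ) h
    rw [Int.cast_sum] at h'
    refine h'.trans ?_
    rw [cast_card_reflections]
    push_cast
    field_simp

/-- The second eigenfunction: subtracting `Δ` from `(n - 1) s` absorbs the drift, since `2 (n - 1) -
(n - 1)(n - 2) = -(n - 1)(n - 4)`. -/
theorem avg_sign_sub (hn : 2 ≤ n) (t : ℕ) {i j : Idx n} (hij : Apart i j) :
    avg (reflections n) t (fun w => (n - 1 : ℝ) *
        ((Int.sign ((((w : Equiv.Perm (Idx n)) i : Idx n) : ℤ) -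
          ((w : Equiv.Perm (Idx n)) j : Idx n)) : ℤ) : ℝ) -
        ((shrink ((w : Equiv.Perm (Idx n)) i) -
          shrink ((w : Equiv.Perm (Idx n)) j) : ℤ) : ℝ)) =
      (1 - 4 / (n : ℝ)) ^ t * ((n - 1 : ℝ) * ((Int.sign ((i : ℤ) - j) : ℤ) : ℝ) -
        ((shrink i - shrink j : ℤ) : ℝ)) := by
  have hn' : (2 : ℝ) ≤ n := by exact_mod_cast hn
  have hn0 : (n : ℝ) ≠ 0 := by positivity
  have hn1 : (n : ℝ) - 1 ≠ 0 := by linarith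
  rw [avg_of_eigen (by rw [cast_card_reflections]; positivity) t _ (1 - 4 / (n : ℝ))]
  · rfl
  · intro w
    have h := congrArg₂ (· - ·) (sum_reflections_shrink ((w : Equiv.Perm (Idx n)) i))
      (sum_reflections_shrink ((w : Equiv.Perm (Idx n)) j))
    simp only [← Finset.sum_sub_distrib] at h
    have h1 := congrArg (Int.cast : ℤ → ℝ) h
    have h2 := congrArg (Int.cast : ℤ → ℝ) (sum_reflections_sign_sub (hij.map w.2.1))
    rw [Int.cast_sum] at h1 h2
    rw [Finset.sum_sub_distrib, ← Finset.mul_sum]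
    refine (congrArg₂ (fun x y : ℝ => (n - 1 : ℝ) * x - y) h2 h1).trans ?_
    rw [cast_card_reflections]
    push_cast
    field_simp
    ring

theorem productProb_descent (hn : 2 ≤ n) (t : ℕ) {i j : Idx n} (hij : Apart i j)
    (hlt : (i : ℤ) < j) :
    productProb (reflections n) t
        (fun π : D n => (((π : Equiv.Perm (Idx n)) j : Idx n) : ℤ) <
          ((π : Equiv.Perm (Idx n)) i : Idx n)) =
      1 / 2 - ((shrink j - shrink i : ℤ) : ℝ) / (2 * ((n : ℝ) - 1)) * (1 - 2 / (n : ℝ)) ^ t +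
        (((shrink j - shrink i : ℤ) : ℝ) / (2 * ((n : ℝ) - 1)) - 1 / 2) *
          (1 - 4 / (n : ℝ)) ^ t := by
  have hn' : (2 : ℝ) ≤ n := by exact_mod_cast hn
  have hn1 : (n : ℝ) - 1 ≠ 0 := by linarith
  have hcard : ((reflections n).card : ℝ) ≠ 0 := by
    rw [cast_card_reflections]
    positivity
  have hconst : avg (reflections n) t (fun _ => (1 / 2 : ℝ)) = 1 / 2 := by
    rw [avg_of_eigen hcard t _ 1 (fun m => by simp)]
    simp
  -- This is `(1 + s) / 2` with `s = (Δ + ((n - 1) s - Δ)) / (n - 1)`.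
  have hdecomp : ∀ w : D n, (if (((w : Equiv.Perm (Idx n)) j : Idx n) : ℤ) <
        ((w : Equiv.Perm (Idx n)) i : Idx n) then (1 : ℝ) else 0) =
      1 / 2 + (1 / (2 * ((n : ℝ) - 1)) * ((shrink ((w : Equiv.Perm (Idx n)) i) -
          shrink ((w : Equiv.Perm (Idx n)) j) : ℤ) : ℝ) +
        1 / (2 * ((n : ℝ) - 1)) * ((n - 1 : ℝ) *
          ((Int.sign ((((w : Equiv.Perm (Idx n)) i : Idx n) : ℤ) -
            ((w : Equiv.Perm (Idx n)) j : Idx n)) : ℤ) : ℝ) -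
          ((shrink ((w : Equiv.Perm (Idx n)) i) -
            shrink ((w : Equiv.Perm (Idx n)) j) : ℤ) : ℝ))) := by
    intro w
    rcases lt_or_gt_of_ne (apart_iff.1 (hij.map w.2.1)).1 with h | h
    · rw [if_neg (by omega), Int.sign_eq_neg_one_of_neg (by omega)]
      push_cast
      field_simp
      ring
    · rw [if_pos h, Int.sign_eq_one_of_pos (by omega)]
      push_cast
      field_simp
      ring
  rw [productProb_eq_avg]
  simp only [hdecomp]
  rw [avg_add, avg_add, avg_const_mul, avg_const_mul, avg_shrink_sub hn, avg_sign_sub hn t hij,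
    hconst, Int.sign_eq_neg_one_of_neg (by omega)]
  push_cast
  field_simp
  ring

theorem length_eq_sum (w : D n) : (length n w : ℝ) = 1 / 2 * ∑ x ∈ rootPairs n,
    (if (((w : Equiv.Perm (Idx n)) x.2 : Idx n) : ℤ) < ((w : Equiv.Perm (Idx n)) x.1 : Idx n)
      then (1 : ℝ) else 0) := by
  have h : (2 : ℝ) * length n w = (inversions (w : Equiv.Perm (Idx n))).card := by
    exact_mod_cast two_mul_length w
  rw [Finset.sum_boole]
  have h' : (inversions (w : Equiv.Perm (Idx n))).card = ((rootPairs n).filter (fun x =>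
    (((w : Equiv.Perm (Idx n)) x.2 : Idx n) : ℤ) <
      ((w : Equiv.Perm (Idx n)) x.1 : Idx n))).card := by
    rw [inversions]
  rw [← h', ← h]
  ring

theorem expectedLength_reflections (hn : 2 ≤ n) (t : ℕ) :
    expectedLength (reflections n) (length n) t =
      (n : ℝ) * ((n : ℝ) - 1) / 2
        - (n : ℝ) * (2 * (n : ℝ) - 1) / 6 * (1 - 2 / (n : ℝ)) ^ t
        - (n : ℝ) * ((n : ℝ) - 2) / 6 * (1 - 4 / (n : ℝ)) ^ t := by
  have hn' : (2 : ℝ) ≤ n := by exact_mod_cast hn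
  have hn1 : (n : ℝ) - 1 ≠ 0 := by linarith
  have hcard : ((rootPairs n).card : ℝ) = 2 * n * (n - 1) := by
    exact_mod_cast congrArg (Int.cast : ℤ → ℝ) card_rootPairs
  have hsum : ∑ x ∈ rootPairs n, ((shrink x.2 - shrink x.1 : ℤ) : ℝ) =
      2 * (n * (n - 1) * (2 * n - 1)) / 3 := by
    have h1 := congrArg (Int.cast : ℤ → ℝ) (sum_shrink_sub_of_rootPairs (n := n))
    have h2 := congrArg (Int.cast : ℤ → ℝ) (sum_shrink_sq (n := n))
    rw [Int.cast_sum] at h1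
    rw [h1]
    push_cast at h2 ⊢
    linarith
  rw [expectedLength_eq_avg]
  simp only [length_eq_sum]
  rw [avg_const_mul, avg_sum]
  -- The probability is affine in `shrink x.2 - shrink x.1`, so only the number of pairs and the sum
  -- of these differences matter.
  have hterm : ∀ x ∈ rootPairs n, avg (reflections n) t
        (fun π : D n => if (((π : Equiv.Perm (Idx n)) x.2 : Idx n) : ℤ) <
          ((π : Equiv.Perm (Idx n)) x.1 : Idx n) then 1 else 0) =
      (1 / 2 - 1 / 2 * (1 - 4 / (n : ℝ)) ^ t) + ((shrink x.2 - shrink x.1 : ℤ) : ℝ) *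
        (((1 - 4 / (n : ℝ)) ^ t - (1 - 2 / (n : ℝ)) ^ t) / (2 * ((n : ℝ) - 1))) := by
    intro x hx
    rw [rootPairs, Finset.mem_filter] at hx
    refine (productProb_eq_avg _ _ _).symm.trans ?_
    rw [productProb_descent hn t hx.2.1 hx.2.2]
    field_simp
    ring
  rw [Finset.sum_congr rfl hterm, Finset.sum_add_distrib, Finset.sum_const, ← Finset.sum_mul,
    hsum, nsmul_eq_mul, hcard]
  field_simp
  ring

theorem length_one : length n 1 = 0 :=
  wordLength_eq ⟨[], by simp⟩ fun _ _ _ => Nat.zero_le _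

end TypeD

theorem mainTheorem3 (n t : ℕ) (hn : 1 ≤ n) (hnt : n = 1 → t = 0) :
    expectedLength (TypeD.reflections n) (TypeD.length n) t =
        (n : ℝ) * ((n : ℝ) - 1) / 2
          - (n : ℝ) * (2 * (n : ℝ) - 1) / 6 * (1 - 2 / (n : ℝ)) ^ t
          - (n : ℝ) * ((n : ℝ) - 2) / 6 * (1 - 4 / (n : ℝ)) ^ t ∧
    ∀ i j : TypeD.Idx n, |(i : ℤ)| < (j : ℤ) →
      productProb (TypeD.reflections n) t
          (fun π : TypeD.D n =>
            (((π : Equiv.Perm (TypeD.Idx n)) j : TypeD.Idx n) : ℤ) <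
              (((π : Equiv.Perm (TypeD.Idx n)) i : TypeD.Idx n) : ℤ)) =
        1 / 2
          - (((j : ℤ) : ℝ) - ((i : ℤ) : ℝ) - 1 + ((Int.sign (i : ℤ) : ℤ) : ℝ))
              / (2 * ((n : ℝ) - 1)) * (1 - 2 / (n : ℝ)) ^ t
          + ((((j : ℤ) : ℝ) - ((i : ℤ) : ℝ) - 1 + ((Int.sign (i : ℤ) : ℤ) : ℝ))
              / (2 * ((n : ℝ) - 1)) - 1 / 2) * (1 - 4 / (n : ℝ)) ^ t := by
  rcases eq_or_lt_of_le hn with rfl | hn2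
  -- For `n = 1`, `t = 0` the formula reads `0 - 1/6 + 1/6 = 0`, and no pair satisfies `|i| < j`.
  · obtain rfl := hnt rfl
    constructor
    · have h1 : ∀ r : Fin 0 → TypeD.D 1, (List.ofFn r).prod = 1 := fun r => by simp
      simp only [expectedLength, h1, TypeD.length_one]
      norm_num
    · intro i j hij
      have hi := TypeD.idx_bounds i
      have hj := TypeD.idx_bounds j
      rw [abs_lt] at hij
      push_cast at hi hj
      omega
  · refine ⟨TypeD.expectedLength_reflections hn2 t, fun i j hij => ?_⟩
    have hij' := abs_lt.1 hij
    have hs : TypeD.shrink j - TypeD.shrink i = (j : ℤ) - i - 1 + Int.sign (i : ℤ) := by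
      rw [TypeD.shrink, TypeD.shrink, Int.sign_eq_one_of_pos (by omega : 0 < (j : ℤ))]
      ring
    rw [TypeD.productProb_descent hn2 t (TypeD.apart_of_abs_lt hij) (by omega), hs]
    push_cast
    rfl
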